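/- **Syntax.** Formulas of continuous Markovian logic (CML) are $\varphi ::= \top \mid \lnot\varphi \mid \varphi\land\varphi \mid L_r\varphi$ with $r\in\mathbb{Q}_{\ge 0}$; put $\bot=\lnot\top$ and $\varphi\to\psi=\lnot(\varphi\land\lnot\psi)$. **Semantics.** An analytic space is (up to homeomorphism) the image of a Polish space under a continuous map into a Polish space, with the subspace topology. A continuous Markov kernel is an analytic space $M$ with its Borel $\sigma$-algebra $\Sigma$ and a map $\theta$ from $M$ to the set $\Delta(M,\Sigma)$ of finite measures on $(M,\Sigma)$ that is measurable for the $\sigma$-algebra generated by the sets $\{\mu:\mu(S)\ge r\}$ ($S\in\Sigma$, $r>0$). For rational $\varepsilon\ge 0$ and $m\in M$, define $m\models_\varepsilon\varphi$ by the usual Boolean clauses for $\top,\lnot,\land$ and $$m\models_\varepsilon L_r\varphi\iff \theta(m)(\{n\in M: n\models_\varepsilon\varphi\})+\varepsilon\ge r .$$ A formula $\varphi$ is $\varepsilon$-satisfiable if $m\models_\varepsilon\varphi$ for some state $m$ of some continuous Markov kernel, and $\varepsilon$-valid, $\models_\varepsilon\varphi$, if $\lnot\varphi$ is not $\varepsilon$-satisfiable.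 **Provability.** Let $\Phi\vdash_\varepsilon\varphi$ ($\Phi$ a set of formulas) be the least relation that contains classical propositional logic, i.e. $\Phi\vdash_\varepsilon\varphi$ for $\varphi\in\Phi$ and for $\varphi$ an instance of a propositional tautology, modus ponens, and the deduction rule "if $\Phi\cup\{\varphi\}\vdash_\varepsilon\psi$ then $\Phi\vdash_\varepsilon\varphi\to\psi$", and that satisfies, for all formulas $\varphi,\psi$, all $r,s\in\mathbb{Q}_{\ge0}$ (with $r+s\ge\varepsilon$ in (A3), (A4)) and all $\Phi$: * (A1) $\Phi\vdash_\varepsilon L_\varepsilon\varphi$; * (A2) $\Phi\vdash_\varepsilon L_{r+s}\varphi\to L_r\varphi$; * (A3) $\Phi\vdash_\varepsilon L_r(\varphi\land\psi)\land L_s(\varphi\land\lnot\psi)\to L_{r+s-\varepsilon}\varphi$; * (A4) $\Phi\vdash_\varepsilon \lnot L_r(\varphi\land\psi)\land\lnot L_s(\varphi\land\lnot\psi)\to\lnot L_{r+s-\varepsilon}\varphi$; * (R1) if $\emptyset\vdash_\varepsilon\varphi\to\psi$ then $\Phi\vdash_\varepsilon L_r\varphi\to L_r\psi$; * (R2) if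 $\Phi\vdash_\varepsilon L_r\varphi$ for all rational $r$ with $0\le r<s$, then $\Phi\vdash_\varepsilon L_s\varphi$; * (R3) if $\Phi\vdash_\varepsilon L_r\varphi$ for all rational $r>s$, then $\Phi\vdash_\varepsilon\bot$. Write $\vdash_\varepsilon\varphi$ for $\emptyset\vdash_\varepsilon\varphi$. **Theorem (Soundness and Weak Completeness).** For every rational $\varepsilon\ge 0$ and every formula $\varphi$ of CML, $\vdash_\varepsilon\varphi$ if and only if $\models_\varepsilon\varphi$. -/

import Mathlib

universe u

namespace CML

/-! ### Syntax -/

/-- Formulas of continuous Markovian logic, `φ ::= ⊤ | ¬φ | φ ∧ φ | L_r φ`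
with `r` a nonnegative rational. -/
inductive Formula : Type
  | top : Formula
  | neg : Formula → Formula
  | and : Formula → Formula → Formula
  | L : ℚ≥0 → Formula → Formula

namespace Formula

/-- Falsum, `⊥ = ¬⊤`. -/
def bot : Formula := neg top

/-- Material implication, as the usual abbreviation `φ → ψ = ¬(φ ∧ ¬ψ)`. -/
def imp (φ ψ : Formula) : Formula := neg (and φ (neg ψ))

end Formula

open Formula

/-! ### Models -/

/-- `M` is an analytic space: up to homeomorphism, an analytic subset of a Polish space, that is,
the image of a Polish space under a continuous map into a Polish space (or the empty set, which is
the image of the empty Polish space). -/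
def IsAnalyticSpace (M : Type u) [TopologicalSpace M] : Prop :=
  ∃ (Y : Type u) (_ : TopologicalSpace Y) (_ : PolishSpace Y) (e : M → Y),
    Topology.IsEmbedding e ∧ MeasureTheory.AnalyticSet (Set.range e)

/-- A continuous Markov kernel: an analytic space with its Borel σ-algebra and a measurable map
`θ` from states to finite measures. `MeasureTheory.Measure M` carries the σ-algebra generated by
the evaluations `μ ↦ μ S` at measurable `S`. The finiteness of `θ m` is not uniform in `m`. -/
structure Kernel : Type (u + 1) where
  /-- the support set -/
  M : Type u
  [top : TopologicalSpace M]
  [meas : MeasurableSpace M]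
  [borel : BorelSpace M]
  analytic : IsAnalyticSpace M
  θ : M → MeasureTheory.Measure M
  measurable_θ : Measurable θ
  finite_θ : ∀ m, MeasureTheory.IsFiniteMeasure (θ m)

attribute [instance] Kernel.top Kernel.meas Kernel.borel Kernel.finite_θ

/-! ### Semantics -/

/-- The set `⟦φ⟧_ε` of states of `K` that `ε`-satisfy `φ`. -/
def den (K : Kernel.{u}) (ε : ℚ≥0) : Formula → Set K.M
  | .top => Set.univ
  | .neg φ => (den K ε φ)ᶜ
  | .and φ ψ => den K ε φ ∩ den K ε ψ
  | .L r φ => {m | (K.θ m).real (den K ε φ) + (ε : ℝ) ≥ (r : ℝ)}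

/-- `m ⊨_ε φ`, for a continuous Markov process `(K, m)`. -/
def Sat (K : Kernel.{u}) (ε : ℚ≥0) (m : K.M) (φ : Formula) : Prop := m ∈ den K ε φ

/-- The sets `⟦φ⟧_ε` are measurable, so that `θ m` is only ever evaluated at measurable sets. -/
theorem measurableSet_den (K : Kernel.{u}) (ε : ℚ≥0) (φ : Formula) :
    MeasurableSet (den K ε φ) := by
  induction φ with
  | top => exact MeasurableSet.univ
  | neg φ ih => exact ih.compl
  | and φ ψ ih₁ ih₂ => exact ih₁.inter ih₂
  | L r φ ih =>
    have h : Measurable fun m => (K.θ m).real (den K ε φ) :=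
      ((MeasureTheory.Measure.measurable_coe ih).comp K.measurable_θ).ennreal_toReal
    exact measurableSet_le measurable_const (h.add_const _)

/-- `φ` is `ε`-satisfiable: some continuous Markov process `ε`-satisfies it. -/
def Satisfiable (ε : ℚ≥0) (φ : Formula) : Prop :=
  ∃ (K : Kernel.{u}) (m : K.M), Sat K ε m φ

/-- `⊨_ε φ`: the formula `φ` is `ε`-valid, i.e. `¬φ` is not `ε`-satisfiable. -/
def Valid (ε : ℚ≥0) (φ : Formula) : Prop := ¬ Satisfiable.{u} ε (neg φ)

/-! ### Provability -/

/-- `φ` is an instance of a classical propositional tautology: it is true under every assignment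
of truth values to formulas that respects the Boolean connectives (and treats the formulas `L_r ψ`
as atoms). -/
def IsTautology (φ : Formula) : Prop :=
  ∀ v : Formula → Prop, v top → (∀ ψ, v (neg ψ) ↔ ¬ v ψ) →
    (∀ ψ χ, v (and ψ χ) ↔ (v ψ ∧ v χ)) → v φ

/-- `Derives ε Φ φ` is `Φ ⊢_ε φ`. The first four constructors are classical propositional
logic as a derivability relation; the others are the axioms (A1)-(A4) and the rules (R1)-(R3).
(R1) applies to theorems. (A3) and (A4) are stated for those `r, s` for which `r + s - ε` is an
index of the language. -/
inductive Derives (ε : ℚ≥0) : Set Formula → Formula → Prop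
  | hyp {Φ : Set Formula} {φ : Formula} : φ ∈ Φ → Derives ε Φ φ
  | taut {Φ : Set Formula} {φ : Formula} : IsTautology φ → Derives ε Φ φ
  | mp {Φ : Set Formula} {φ ψ : Formula} :
      Derives ε Φ (imp φ ψ) → Derives ε Φ φ → Derives ε Φ ψ
  | imp_intro {Φ : Set Formula} {φ ψ : Formula} :
      Derives ε (insert φ Φ) ψ → Derives ε Φ (imp φ ψ)
  | A1 {Φ : Set Formula} (φ : Formula) : Derives ε Φ (L ε φ)
  | A2 {Φ : Set Formula} (r s : ℚ≥0) (φ : Formula) :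
      Derives ε Φ (imp (L (r + s) φ) (L r φ))
  | A3 {Φ : Set Formula} (r s : ℚ≥0) (φ ψ : Formula) : ε ≤ r + s →
      Derives ε Φ (imp (and (L r (and φ ψ)) (L s (and φ (neg ψ)))) (L (r + s - ε) φ))
  | A4 {Φ : Set Formula} (r s : ℚ≥0) (φ ψ : Formula) : ε ≤ r + s →
      Derives ε Φ (imp (and (neg (L r (and φ ψ))) (neg (L s (and φ (neg ψ)))))
        (neg (L (r + s - ε) φ)))
  | R1 {Φ : Set Formula} (r : ℚ≥0) {φ ψ : Formula} :
      Derives ε ∅ (imp φ ψ) → Derives ε Φ (imp (L r φ) (L r ψ))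
  | R2 {Φ : Set Formula} (s : ℚ≥0) (φ : Formula) :
      (∀ r : ℚ≥0, r < s → Derives ε Φ (L r φ)) → Derives ε Φ (L s φ)
  | R3 {Φ : Set Formula} (s : ℚ≥0) (φ : Formula) :
      (∀ r : ℚ≥0, s < r → Derives ε Φ (L r φ)) → Derives ε Φ bot

/-- `⊢_ε φ`: the formula `φ` is `ε`-provable. -/
def Provable (ε : ℚ≥0) (φ : Formula) : Prop := Derives ε ∅ φ

end CML

/-!
Soundness is an induction on derivations: every rule preserves truth at each state, relative to a
set of hypotheses.

For completeness, a consistent formula is satisfied in a finite model. The sets of formulas that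
play the role of ultrafilters are the *saturated* sets (`IsSaturated`): prime theories that moreover
respect each instance of the infinitary rules (R2) and (R3). There are countably many such
instances, so the Rasiowa–Sikorski lemma extends every consistent set to a saturated one
(`exists_isSaturated`).

In a saturated set `Γ` the formulas `L_r α` are those with `r ≤ mass ε Γ α + ε`, where
`mass ε Γ α = sup {r | L_r α ∈ Γ} - ε` (`IsSaturated.L_mem_iff`): (R3) makes the supremum finite and
(R2) makes it attained. By (A3) and (A4) the mass is finitely additive (`IsSaturated.mass_add`), and
by (R1) it only depends on formulas up to provable equivalence.

Given finitely many formulas, closed under subformulas, the states of the model are the consistent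
`atoms`, that is, conjunctions of literals over these formulas. Each atom `χ` is placed in a
saturated set `Γ_χ`, and the transition measure at `χ` gives to an atom `χ'` the weight
`mass ε Γ_χ χ'`. As (R2) and (R3) already hold in `Γ_χ`, no bound on the rational indices is needed,
and as there are finitely many atoms, finite additivity suffices for the truth lemma
(`mem_den_atomKernel`).
-/

namespace CML

open Formula

/-! ### Propositional reasoning -/

/-- A truth assignment to formulas that respects the Boolean connectives. -/
structure IsValuation (v : Formula → Prop) : Prop where
  top : v top
  neg : ∀ α, v (neg α) ↔ ¬ v α
  and : ∀ α β, v (and α β) ↔ (v α ∧ v β)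

variable {ε : ℚ≥0} {Φ Ψ Γ : Set Formula} {α β γ : Formula}

namespace IsValuation

variable {v : Formula → Prop}

theorem imp (hv : IsValuation v) : v (imp α β) ↔ (v α → v β) := by
  simp only [Formula.imp, hv.neg, hv.and]; tauto

theorem bot (hv : IsValuation v) : ¬ v bot := by
  simp [Formula.bot, hv.neg, hv.top]

end IsValuation

namespace Derives

theorem of_valuation (h : ∀ v, IsValuation v → v α) : Derives ε Φ α :=
  .taut fun v h₁ h₂ h₃ => h v ⟨h₁, h₂, h₃⟩

theorem of_valuation₁ (h : ∀ v, IsValuation v → v α → v β) (hα : Derives ε Φ α) :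
    Derives ε Φ β :=
  .mp (of_valuation fun v hv => hv.imp.2 (h v hv)) hα

theorem of_valuation₂ (h : ∀ v, IsValuation v → v α → v β → v γ) (hα : Derives ε Φ α)
    (hβ : Derives ε Φ β) : Derives ε Φ γ :=
  .mp (of_valuation₁ (fun v hv hα => hv.imp.2 (h v hv hα)) hα) hβ

theorem mono (h : Derives ε Φ α) (hΦ : Φ ⊆ Ψ) : Derives ε Ψ α := by
  induction h generalizing Ψ with
  | hyp h => exact .hyp (hΦ h)
  | taut h => exact .taut h
  | mp _ _ ih₁ ih₂ => exact .mp (ih₁ hΦ) (ih₂ hΦ)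
  | imp_intro _ ih => exact .imp_intro (ih (Set.insert_subset_insert hΦ))
  | A1 φ => exact .A1 φ
  | A2 r s φ => exact .A2 r s φ
  | A3 r s φ ψ h => exact .A3 r s φ ψ h
  | A4 r s φ ψ h => exact .A4 r s φ ψ h
  | R1 r h _ => exact .R1 r h
  | R2 s φ _ ih => exact .R2 s φ fun r hr => ih r hr hΦ
  | R3 s φ _ ih => exact .R3 s φ fun r hr => ih r hr hΦ

theorem neg_of_insert (h : Derives ε (insert α Φ) bot) : Derives ε Φ (neg α) :=
  of_valuation₁ (fun v hv => by simp [hv.imp, hv.neg, hv.bot]) h.imp_intro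

theorem of_insert_neg (h : Derives ε (insert (neg α) Φ) bot) : Derives ε Φ α :=
  of_valuation₁ (fun v hv => by simp [hv.neg]) h.neg_of_insert

theorem bot_of_neg (h₁ : Derives ε Φ α) (h₂ : Derives ε Φ (neg α)) : Derives ε Φ bot :=
  of_valuation₂ (fun v hv => by simp only [hv.neg]; tauto) h₁ h₂

end Derives

/-! ### Soundness -/

theorem mem_den_imp (K : Kernel.{u}) (m : K.M) :
    m ∈ den K ε (imp α β) ↔ (m ∈ den K ε α → m ∈ den K ε β) := by
  simp only [imp, den, Set.mem_compl_iff, Set.mem_inter_iff]; tauto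

theorem measureReal_den_split (K : Kernel.{u}) (m : K.M) (α β : Formula) :
    (K.θ m).real (den K ε (and α β)) + (K.θ m).real (den K ε (and α (neg β))) =
      (K.θ m).real (den K ε α) :=
  MeasureTheory.measureReal_inter_add_sdiff (measurableSet_den K ε β)

theorem cast_add_tsub {r s : ℚ≥0} (h : ε ≤ r + s) : ((r + s - ε : ℚ≥0) : ℝ) = r + s - ε := by
  rw [eq_sub_iff_add_eq]
  exact_mod_cast tsub_add_cancel_of_le h

theorem Derives.sound (h : Derives ε Φ α) (K : Kernel.{u}) (m : K.M)
    (hm : ∀ β ∈ Φ, m ∈ den K ε β) : m ∈ den K ε α := by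
  induction h generalizing m with
  | hyp h => exact hm _ h
  | taut h => exact h (fun ψ => m ∈ den K ε ψ) trivial (fun _ => Iff.rfl) fun _ _ => Iff.rfl
  | mp _ _ ih₁ ih₂ => exact (mem_den_imp K m).1 (ih₁ m hm) (ih₂ m hm)
  | imp_intro _ ih =>
    exact (mem_den_imp K m).2 fun h => ih m (by rintro β (rfl | hβ); exacts [h, hm β hβ])
  | A1 φ => simp [den]
  | A2 r s φ =>
    refine (mem_den_imp K m).2 fun h => ?_
    simp only [den, Set.mem_ofPred_eq, NNRat.cast_add] at h ⊢
    have : (0 : ℝ) ≤ s := s.cast_nonneg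
    linarith
  | A3 r s φ ψ hrs =>
    refine (mem_den_imp K m).2 fun h => ?_
    obtain ⟨h₁, h₂⟩ := h
    have := measureReal_den_split (ε := ε) K m φ ψ
    simp only [den, Set.mem_ofPred_eq, cast_add_tsub hrs] at h₁ h₂ this ⊢
    linarith
  | A4 r s φ ψ hrs =>
    refine (mem_den_imp K m).2 fun h => ?_
    obtain ⟨h₁, h₂⟩ := h
    have := measureReal_den_split (ε := ε) K m φ ψ
    simp only [den, Set.mem_ofPred_eq, cast_add_tsub hrs,
      Set.mem_compl_iff, not_le, ge_iff_le] at h₁ h₂ this ⊢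
    linarith
  | R1 r _ ih =>
    refine (mem_den_imp K m).2 fun h => ?_
    simp only [den, Set.mem_ofPred_eq] at h ⊢
    refine le_trans h (add_le_add_left (MeasureTheory.measureReal_mono fun n hn => ?_) _)
    exact (mem_den_imp K n).1 (ih n (by simp)) hn
  | R2 s φ _ ih =>
    by_contra hs
    simp only [den, Set.mem_ofPred_eq, not_le, ge_iff_le] at hs
    obtain ⟨q, hq₁, hq₂⟩ := exists_rat_btwn hs
    have hq : 0 ≤ q := by
      have : (0 : ℝ) < q := lt_of_le_of_lt (by positivity) hq₁
      exact_mod_cast this.le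
    lift q to ℚ≥0 using hq
    have := ih q (by exact_mod_cast hq₂) m hm
    simp only [den, Set.mem_ofPred_eq] at this
    push_cast at hq₁
    linarith
  | R3 s φ _ ih =>
    exfalso
    obtain ⟨n, hn⟩ := exists_nat_gt ((K.θ m).real (den K ε φ) + ε)
    have := ih (s + (n + 1)) (by rw [lt_add_iff_pos_right]; positivity) m hm
    simp only [den, Set.mem_ofPred_eq] at this
    push_cast at this
    have : (0 : ℝ) ≤ s := s.cast_nonneg
    linarith

/-! ### Saturated sets -/

/-- A code of a formula by a natural number. -/
def Formula.code : Formula → ℕ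
  | .top => Nat.pair 0 0
  | .neg α => Nat.pair 1 α.code
  | .and α β => Nat.pair 2 (Nat.pair α.code β.code)
  | .L r α => Nat.pair 3 (Nat.pair (Encodable.encode r) α.code)

theorem Formula.code_injective : Function.Injective Formula.code := by
  intro α
  induction α with
  | top => intro β h; cases β <;> simp_all [code]
  | neg α ih =>
    intro β h
    cases β <;> simp [code] at h ⊢
    exact ih h
  | and α₁ α₂ ih₁ ih₂ =>
    intro β h
    cases β <;> simp [code] at h ⊢
    exact ⟨ih₁ h.1, ih₂ h.2⟩
  | L r α ih =>
    intro β h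
    cases β <;> simp [code] at h ⊢
    exact ⟨h.1, ih h.2⟩

instance : Countable Formula := Formula.code_injective.countable

/-- A prime theory that is closed under the infinitary rules (R2) and (R3): it contains the
conclusion of every instance of (R2) whose premises it contains, and it omits a premise of every
instance of (R3). For (R3) it is enough that some `L_r α` is omitted, because of (A2). -/
structure IsSaturated (ε : ℚ≥0) (Γ : Set Formula) : Prop where
  neg_mem_iff : ∀ {α}, neg α ∈ Γ ↔ α ∉ Γ
  mp : ∀ {α β}, Provable ε (imp α β) → α ∈ Γ → β ∈ Γ
  and_mem : ∀ {α β}, α ∈ Γ → β ∈ Γ → and α β ∈ Γ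
  L_mem : ∀ {α} {s : ℚ≥0}, (∀ r < s, L r α ∈ Γ) → L s α ∈ Γ
  exists_L_notMem : ∀ α, ∃ r, L r α ∉ Γ

/-- A set of formulas that does not derive `⊥`. -/
def Consistent (ε : ℚ≥0) (Φ : Set Formula) : Prop := ¬ Derives ε Φ bot

/-- The consistent sets that decide `α` and, if `α` is of the form `L_s β` and is refuted, also
refute a premise of the instance of (R2) that concludes it. -/
def decidingSets (ε : ℚ≥0) (α : Formula) : Order.Cofinal {Φ : Set Formula // Consistent ε Φ} where
  carrier := {Φ | α ∈ Φ.1 ∨ neg α ∈ Φ.1 ∧ ∀ s β, α = L s β → ∃ r < s, neg (L r β) ∈ Φ.1}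
  isCofinal := by
    rintro ⟨Φ, hΦ⟩
    by_cases h : Consistent ε (insert α Φ)
    · exact ⟨⟨_, h⟩, .inl (Set.mem_insert _ _), Set.subset_insert _ _⟩
    have hα := (not_not.1 h).neg_of_insert
    have h₁ : Consistent ε (insert (neg α) Φ) := fun h' => hΦ (h'.of_insert_neg.bot_of_neg hα)
    by_cases hL : ∃ s β, α = L s β
    · obtain ⟨s, β, rfl⟩ := hL
      obtain ⟨r, hr, h₂⟩ : ∃ r < s, Consistent ε (insert (neg (L r β)) Φ) := by
        by_contra! hcon
        exact hΦ <| Derives.bot_of_neg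
          (.R2 s β fun r hr => (not_not.1 (hcon r hr)).of_insert_neg) hα
      refine ⟨⟨insert (neg (L s β)) (insert (neg (L r β)) Φ), fun h' => h₂ ?_⟩,
        .inr ⟨Set.mem_insert _ _, ?_⟩,
        (Set.subset_insert _ _).trans (Set.subset_insert _ _)⟩
      · exact h'.of_insert_neg.bot_of_neg (hα.mono (Set.subset_insert _ _))
      · rintro _ _ ⟨⟩
        exact ⟨r, hr, by simp⟩
    · push Not at hL
      exact ⟨⟨_, h₁⟩, .inr ⟨Set.mem_insert _ _, fun s β h => (hL s β h).elim⟩,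
        Set.subset_insert _ _⟩

/-- The consistent sets that refute some `L_r α`. -/
def boundingSets (ε : ℚ≥0) (α : Formula) : Order.Cofinal {Φ : Set Formula // Consistent ε Φ} where
  carrier := {Φ | ∃ r, neg (L r α) ∈ Φ.1}
  isCofinal := by
    rintro ⟨Φ, hΦ⟩
    obtain ⟨r, hr⟩ : ∃ r, Consistent ε (insert (neg (L r α)) Φ) := by
      by_contra! hcon
      exact hΦ <| .R3 0 α fun r _ => (not_not.1 (hcon r)).of_insert_neg
    exact ⟨⟨_, hr⟩, ⟨r, Set.mem_insert _ _⟩, Set.subset_insert _ _⟩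

/-- Lindenbaum's lemma for the infinitary calculus, from the Rasiowa–Sikorski lemma. -/
theorem exists_isSaturated (hΦ : Consistent ε Φ) : ∃ Γ, Φ ⊆ Γ ∧ IsSaturated ε Γ := by
  have := Encodable.ofCountable (Formula ⊕ Formula)
  let 𝒟 : Formula ⊕ Formula → Order.Cofinal {Φ : Set Formula // Consistent ε Φ} :=
    Sum.elim (decidingSets ε) (boundingSets ε)
  let I := Order.idealOfCofinals ⟨Φ, hΦ⟩ 𝒟
  -- The saturated set is the union of the generic ideal `I`.
  have hdir : ∀ Φ₁ ∈ I, ∀ Φ₂ ∈ I, ∃ Φ₃ ∈ I, Φ₁ ≤ Φ₃ ∧ Φ₂ ≤ Φ₃ := I.directed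
  have hdec : ∀ α, ∃ Φ ∈ I,
      α ∈ Φ.1 ∨ neg α ∈ Φ.1 ∧ ∀ s β, α = L s β → ∃ r < s, neg (L r β) ∈ Φ.1 := fun α =>
    let ⟨Φ, h₁, h₂⟩ := Order.cofinal_meets_idealOfCofinals ⟨Φ, hΦ⟩ 𝒟 (.inl α)
    ⟨Φ, h₂, h₁⟩
  have hbdd : ∀ α, ∃ Φ ∈ I, ∃ r, neg (L r α) ∈ Φ.1 := fun α =>
    let ⟨Φ, h₁, h₂⟩ := Order.cofinal_meets_idealOfCofinals ⟨Φ, hΦ⟩ 𝒟 (.inr α)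
    ⟨Φ, h₂, h₁⟩
  let Γ : Set Formula := {α | ∃ Φ ∈ I, α ∈ Φ.1}
  have hneg : ∀ {α}, neg α ∈ Γ → α ∉ Γ := by
    rintro α ⟨Φ₁, h₁, hα₁⟩ ⟨Φ₂, h₂, hα₂⟩
    obtain ⟨Φ₃, -, h₁₃, h₂₃⟩ := hdir Φ₁ h₁ Φ₂ h₂
    exact Φ₃.2 (Derives.bot_of_neg (.hyp (h₂₃ hα₂)) (.hyp (h₁₃ hα₁)))
  have hmem : ∀ Φ₁ ∈ I, ∀ {α}, Derives ε Φ₁.1 α → α ∈ Γ := by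
    intro Φ₁ h₁ α hα
    obtain ⟨Φ₂, h₂, hα₂ | ⟨hα₂, -⟩⟩ := hdec α
    · exact ⟨Φ₂, h₂, hα₂⟩
    · obtain ⟨Φ₃, -, h₁₃, h₂₃⟩ := hdir Φ₁ h₁ Φ₂ h₂
      exact (Φ₃.2 (Derives.bot_of_neg (hα.mono h₁₃) (.hyp (h₂₃ hα₂)))).elim
  refine ⟨Γ, fun α hα => ⟨_, Order.mem_idealOfCofinals _ _, hα⟩,
    ⟨⟨hneg, fun h => ?_⟩, ?_, ?_, ?_, ?_⟩⟩
  · obtain ⟨Φ₁, h₁, hα | ⟨hα, -⟩⟩ := hdec _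
    exacts [(h ⟨Φ₁, h₁, hα⟩).elim, ⟨Φ₁, h₁, hα⟩]
  · rintro α β h ⟨Φ₁, h₁, hα⟩
    exact hmem Φ₁ h₁ (.mp (h.mono (Set.empty_subset _)) (.hyp hα))
  · rintro α β ⟨Φ₁, h₁, hα⟩ ⟨Φ₂, h₂, hβ⟩
    obtain ⟨Φ₃, h₃, h₁₃, h₂₃⟩ := hdir Φ₁ h₁ Φ₂ h₂
    exact hmem Φ₃ h₃ (Derives.of_valuation₂ (fun v hv a b => (hv.and _ _).2 ⟨a, b⟩)
      (.hyp (h₁₃ hα)) (.hyp (h₂₃ hβ)))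
  · intro α s h
    obtain ⟨Φ₁, h₁, hα | ⟨-, hα⟩⟩ := hdec (L s α)
    · exact ⟨Φ₁, h₁, hα⟩
    · obtain ⟨r, hr, hr'⟩ := hα s α rfl
      exact (hneg ⟨Φ₁, h₁, hr'⟩ (h r hr)).elim
  · intro α
    obtain ⟨Φ₁, h₁, r, hr⟩ := hbdd α
    exact ⟨r, hneg ⟨Φ₁, h₁, hr⟩⟩

/-! ### The finitely additive measure of a saturated set -/

/-- The measure that the saturated set `Γ` assigns to the formula `α`. The subtraction of `ε`
accounts for the error term in the semantics of `L_r`. -/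
noncomputable def mass (ε : ℚ≥0) (Γ : Set Formula) (α : Formula) : ℝ :=
  sSup ((fun r : ℚ≥0 => (r : ℝ)) '' {r | L r α ∈ Γ}) - ε

namespace IsSaturated

theorem mem_of_provable (hΓ : IsSaturated ε Γ) (h : Provable ε α) : α ∈ Γ := by
  by_contra hα
  exact hα (hΓ.mp (Derives.of_valuation₁ (fun v hv h => hv.imp.2 fun _ => h) h)
    (hΓ.neg_mem_iff.2 hα))

theorem and_mem_iff (hΓ : IsSaturated ε Γ) : and α β ∈ Γ ↔ α ∈ Γ ∧ β ∈ Γ := by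
  refine ⟨fun h => ⟨hΓ.mp (Derives.of_valuation ?_) h, hΓ.mp (Derives.of_valuation ?_) h⟩,
    fun h => hΓ.and_mem h.1 h.2⟩ <;>
  · intro v hv
    simp only [hv.imp, hv.and]; tauto

theorem L_mem_of_le (hΓ : IsSaturated ε Γ) {r s : ℚ≥0} (hrs : r ≤ s) (h : L s α ∈ Γ) :
    L r α ∈ Γ := by
  obtain ⟨t, rfl⟩ := exists_add_of_le hrs
  exact hΓ.mp (.A2 r t α) h

theorem bddAbove (hΓ : IsSaturated ε Γ) (α : Formula) :
    BddAbove ((fun r : ℚ≥0 => (r : ℝ)) '' {r | L r α ∈ Γ}) := by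
  obtain ⟨s, hs⟩ := hΓ.exists_L_notMem α
  refine ⟨s, ?_⟩
  rintro _ ⟨r, hr, rfl⟩
  by_contra! h
  exact hs (hΓ.L_mem_of_le (by exact_mod_cast h.le) hr)

theorem image_nonempty (hΓ : IsSaturated ε Γ) (α : Formula) :
    ((fun r : ℚ≥0 => (r : ℝ)) '' {r | L r α ∈ Γ}).Nonempty :=
  ⟨ε, ε, hΓ.mem_of_provable (.A1 α), rfl⟩

/-- The supremum that defines the mass is attained, by (R2). -/
theorem L_mem_iff (hΓ : IsSaturated ε Γ) {r : ℚ≥0} :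
    L r α ∈ Γ ↔ (r : ℝ) ≤ mass ε Γ α + ε := by
  rw [mass, sub_add_cancel]
  refine ⟨fun h => le_csSup (hΓ.bddAbove α) ⟨r, h, rfl⟩, fun h => hΓ.L_mem fun s hs => ?_⟩
  have hs' : (s : ℝ) < r := by exact_mod_cast hs
  obtain ⟨_, ⟨t, ht, rfl⟩, hst⟩ := exists_lt_of_lt_csSup (hΓ.image_nonempty α) (hs'.trans_le h)
  exact hΓ.L_mem_of_le (NNRat.cast_lt.1 hst).le ht

theorem mass_nonneg (hΓ : IsSaturated ε Γ) (α : Formula) : 0 ≤ mass ε Γ α := by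
  have := hΓ.L_mem_iff.1 (hΓ.mem_of_provable (.A1 α))
  linarith

theorem L_add_mem_iff (hΓ : IsSaturated ε Γ) {p : ℚ≥0} :
    L (ε + p) α ∈ Γ ↔ (p : ℝ) ≤ mass ε Γ α := by
  rw [hΓ.L_mem_iff, NNRat.cast_add, add_comm, add_le_add_iff_right]

theorem mass_mono (hΓ : IsSaturated ε Γ) (h : Provable ε (imp α β)) :
    mass ε Γ α ≤ mass ε Γ β := by
  refine sub_le_sub_right (csSup_le_csSup (hΓ.bddAbove β)
    (hΓ.image_nonempty α) (Set.image_mono fun r hr => ?_)) _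
  exact hΓ.mp (.R1 r h) hr

/-- Additivity: (A3) gives `≥` and (A4) gives `≤`. -/
theorem mass_add (hΓ : IsSaturated ε Γ) (α β : Formula) :
    mass ε Γ α = mass ε Γ (and α β) + mass ε Γ (and α (neg β)) := by
  have key : ∀ p q : ℚ≥0, ε + p + (ε + q) - ε = ε + (p + q) := fun p q => by
    rw [show ε + p + (ε + q) = ε + (p + q) + ε by ring, add_tsub_cancel_right]
  have hle : ∀ p q : ℚ≥0, ε ≤ ε + p + (ε + q) := fun p q => by
    rw [add_assoc]; exact le_self_add
  have h₁ := hΓ.mass_nonneg (and α β)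
  have h₂ := hΓ.mass_nonneg (and α (neg β))
  apply le_antisymm
  · by_contra! h
    set x := mass ε Γ (and α β)
    set y := mass ε Γ (and α (neg β))
    obtain ⟨p, hp₁, hp₂⟩ := exists_rat_btwn (show x < x + (mass ε Γ α - (x + y)) / 2 by linarith)
    obtain ⟨q, hq₁, hq₂⟩ := exists_rat_btwn (show y < y + (mass ε Γ α - (x + y)) / 2 by linarith)
    lift p to ℚ≥0 using by exact_mod_cast (h₁.trans hp₁.le)
    lift q to ℚ≥0 using by exact_mod_cast (h₂.trans hq₁.le)
    push_cast at hp₁ hp₂ hq₁ hq₂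
    have := hΓ.mp (.A4 (ε + p) (ε + q) α β (hle p q)) <| hΓ.and_mem
      (hΓ.neg_mem_iff.2 (mt hΓ.L_add_mem_iff.1 (not_le.2 hp₁)))
      (hΓ.neg_mem_iff.2 (mt hΓ.L_add_mem_iff.1 (not_le.2 hq₁)))
    rw [key, hΓ.neg_mem_iff, hΓ.L_add_mem_iff] at this
    push_cast at this
    linarith
  · by_contra! h
    -- A nonnegative rational below `x`, as close as needed; it has to be `0` when `x = 0`.
    have approx : ∀ x δ : ℝ, 0 ≤ x → 0 < δ → ∃ p : ℚ≥0, (p : ℝ) ≤ x ∧ x - δ < p := by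
      intro x δ hx hδ
      obtain ⟨q, hq₁, hq₂⟩ := exists_rat_btwn (show x - δ < x by linarith)
      rcases le_total 0 q with hq | hq
      · lift q to ℚ≥0 using hq
        exact ⟨q, by exact_mod_cast hq₂.le, by exact_mod_cast hq₁⟩
      · have : (q : ℝ) ≤ 0 := by exact_mod_cast hq
        exact ⟨0, by simpa using hx, by push_cast; linarith⟩
    set x := mass ε Γ (and α β)
    set y := mass ε Γ (and α (neg β))
    obtain ⟨p, hp₁, hp₂⟩ := approx x ((x + y - mass ε Γ α) / 2) h₁ (by linarith)
    obtain ⟨q, hq₁, hq₂⟩ := approx y ((x + y - mass ε Γ α) / 2) h₂ (by linarith)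
    have := hΓ.mp (.A3 (ε + p) (ε + q) α β (hle p q)) <| hΓ.and_mem
      (hΓ.L_add_mem_iff.2 hp₁) (hΓ.L_add_mem_iff.2 hq₁)
    rw [key, hΓ.L_add_mem_iff] at this
    push_cast at this
    linarith

theorem mass_congr (hΓ : IsSaturated ε Γ) (h₁ : Provable ε (imp α β))
    (h₂ : Provable ε (imp β α)) : mass ε Γ α = mass ε Γ β :=
  (hΓ.mass_mono h₁).antisymm (hΓ.mass_mono h₂)

theorem mass_congr_of_valuation (hΓ : IsSaturated ε Γ) (h : ∀ v, IsValuation v → (v α ↔ v β)) :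
    mass ε Γ α = mass ε Γ β :=
  hΓ.mass_congr (Derives.of_valuation fun v hv => hv.imp.2 (h v hv).1)
    (Derives.of_valuation fun v hv => hv.imp.2 (h v hv).2)

theorem mass_eq_zero (hΓ : IsSaturated ε Γ) (h : Provable ε (neg α)) : mass ε Γ α = 0 := by
  -- `α` is equivalent to both `α ∧ ⊤` and `α ∧ ¬⊤`, so its mass is twice itself.
  have h₁ : mass ε Γ α = mass ε Γ (and α top) :=
    hΓ.mass_congr_of_valuation fun v hv => by simp [hv.and, hv.top]
  have h₂ : mass ε Γ α ≤ mass ε Γ (and α (neg top)) := hΓ.mass_mono <|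
    Derives.of_valuation₁ (fun v hv h => hv.imp.2 fun h' => ((hv.neg _).1 h h').elim) h
  have := hΓ.mass_add α top
  linarith [hΓ.mass_nonneg α, hΓ.mass_nonneg (and α (neg top))]

end IsSaturated

/-! ### Atoms -/

open Classical in
/-- The conjunctions of literals over a list of formulas. -/
noncomputable def atoms : List Formula → Finset Formula
  | [] => {top}
  | α :: l => (atoms l).image (and · α) ∪ (atoms l).image (and · (neg α))

theorem mem_atoms_cons {χ : Formula} {l : List Formula} :
    χ ∈ atoms (α :: l) ↔ ∃ χ' ∈ atoms l, χ = and χ' α ∨ χ = and χ' (neg α) := by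
  classical
  simp only [atoms, Finset.mem_union, Finset.mem_image]
  constructor
  · rintro (⟨χ', h, rfl⟩ | ⟨χ', h, rfl⟩)
    exacts [⟨χ', h, .inl rfl⟩, ⟨χ', h, .inr rfl⟩]
  · rintro ⟨χ', h, rfl | rfl⟩
    exacts [.inl ⟨χ', h, rfl⟩, .inr ⟨χ', h, rfl⟩]

/-- An atom decides each of the formulas it is built from. -/
theorem provable_imp_of_mem_atoms {χ : Formula} {l : List Formula} (hχ : χ ∈ atoms l)
    (hα : α ∈ l) : Provable ε (imp χ α) ∨ Provable ε (imp χ (neg α)) := by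
  induction l generalizing χ with
  | nil => simp at hα
  | cons β l ih =>
    obtain ⟨χ', hχ', h⟩ := mem_atoms_cons.1 hχ
    rcases List.mem_cons.1 hα with rfl | hα
    · rcases h with rfl | rfl
      · exact .inl (Derives.of_valuation fun v hv => by simp only [hv.imp, hv.and]; tauto)
      · exact .inr (Derives.of_valuation fun v hv => by simp only [hv.imp, hv.and]; tauto)
    · have hw : ∀ {γ}, Provable ε (imp χ' γ) → Provable ε (imp χ γ) := by
        rcases h with rfl | rfl <;>
        · exact Derives.of_valuation₁ fun v hv => by simp only [hv.imp, hv.and]; tauto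
      exact (ih hχ' hα).imp hw hw

theorem IsSaturated.exists_atom_mem (hΓ : IsSaturated ε Γ) (l : List Formula) :
    ∃ χ ∈ atoms l, χ ∈ Γ := by
  induction l with
  | nil =>
    exact ⟨top, by simp [atoms], hΓ.mem_of_provable (Derives.of_valuation fun v hv => hv.top)⟩
  | cons α l ih =>
    obtain ⟨χ, hχ, hχΓ⟩ := ih
    by_cases hα : α ∈ Γ
    · exact ⟨_, mem_atoms_cons.2 ⟨χ, hχ, .inl rfl⟩, hΓ.and_mem hχΓ hα⟩
    · exact ⟨_, mem_atoms_cons.2 ⟨χ, hχ, .inr rfl⟩, hΓ.and_mem hχΓ (hΓ.neg_mem_iff.2 hα)⟩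

theorem IsSaturated.sum_mass_atoms (hΓ : IsSaturated ε Γ) (α : Formula) (l : List Formula) :
    ∑ χ ∈ atoms l, mass ε Γ (and α χ) = mass ε Γ α := by
  classical
  induction l with
  | nil =>
    simp only [atoms, Finset.sum_singleton]
    exact hΓ.mass_congr_of_valuation fun v hv => by simp [hv.and, hv.top]
  | cons β l ih =>
    rw [atoms, Finset.sum_union, Finset.sum_image (by simp), Finset.sum_image (by simp),
      ← Finset.sum_add_distrib, ← ih]
    · refine Finset.sum_congr rfl fun χ _ => ?_
      rw [hΓ.mass_add (and α χ) β]
      congr 1 <;>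
      · exact hΓ.mass_congr_of_valuation fun v hv => by simp only [hv.and]; tauto
    · -- A formula differs from its negation, so the two kinds of atoms are distinct.
      rw [Finset.disjoint_left]
      simp only [Finset.mem_image, not_exists, not_and]
      rintro _ ⟨χ, -, rfl⟩ χ' - h
      have := congrArg sizeOf (Formula.and.inj h).2
      simp at this

/-! ### The finite model -/

/-- The states of the finite model: the consistent atoms. -/
def AtomState (ε : ℚ≥0) (l : List Formula) : Type u :=
  ULift.{u} {χ : atoms l // Consistent ε {χ.1}}

namespace AtomState

variable {l : List Formula}

instance : Finite (AtomState.{u} ε l) := inferInstanceAs (Finite (ULift _))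

noncomputable instance : Fintype (AtomState.{u} ε l) := Fintype.ofFinite _

instance : TopologicalSpace (AtomState.{u} ε l) := ⊥

instance : DiscreteTopology (AtomState.{u} ε l) := ⟨rfl⟩

instance : MeasurableSpace (AtomState.{u} ε l) := ⊤

instance : DiscreteMeasurableSpace (AtomState.{u} ε l) := ⟨fun _ => trivial⟩

/-- The atom that a state stands for. -/
def atom (x : AtomState.{u} ε l) : Formula := x.down.1

theorem atom_mem (x : AtomState.{u} ε l) : x.atom ∈ atoms l := x.down.1.2

/-- A saturated set that contains the atom of the state. -/
noncomputable def theory (x : AtomState.{u} ε l) : Set Formula :=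
  (exists_isSaturated x.down.2).choose

theorem isSaturated_theory (x : AtomState.{u} ε l) : IsSaturated ε x.theory :=
  (exists_isSaturated x.down.2).choose_spec.2

theorem atom_mem_theory (x : AtomState.{u} ε l) : x.atom ∈ x.theory :=
  (exists_isSaturated x.down.2).choose_spec.1 rfl

theorem mem_theory_iff (x : AtomState.{u} ε l) (hα : α ∈ l) :
    α ∈ x.theory ↔ Provable ε (imp x.atom α) := by
  refine ⟨fun h => (provable_imp_of_mem_atoms x.atom_mem hα).resolve_right fun h' => ?_,
    fun h => x.isSaturated_theory.mp h x.atom_mem_theory⟩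
  exact x.isSaturated_theory.neg_mem_iff.1 (x.isSaturated_theory.mp h' x.atom_mem_theory) h

/-- The transition measure: each atom is weighted with its mass in the theory of the state. -/
noncomputable def transition (x : AtomState.{u} ε l) :
    MeasureTheory.Measure (AtomState.{u} ε l) :=
  ∑ y, ENNReal.ofReal (mass ε x.theory y.atom) • MeasureTheory.Measure.dirac y

open Classical in
theorem transition_apply (x : AtomState.{u} ε l) (S : Set (AtomState.{u} ε l)) :
    x.transition S = ENNReal.ofReal (∑ y with y ∈ S, mass ε x.theory y.atom) := by
  rw [ENNReal.ofReal_sum_of_nonneg fun y _ => x.isSaturated_theory.mass_nonneg _,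
    Finset.sum_filter, transition, MeasureTheory.Measure.finsetSum_apply]
  refine Finset.sum_congr rfl fun y _ => ?_
  by_cases hy : y ∈ S <;> simp [hy]

/-- The transition measure agrees with the mass on the formulas decided by the atoms. -/
theorem transition_real (x : AtomState.{u} ε l) (hα : α ∈ l) :
    x.transition.real {y | α ∈ y.theory} = mass ε x.theory α := by
  classical
  have hx := x.isSaturated_theory
  rw [MeasureTheory.measureReal_def, transition_apply,
    ENNReal.toReal_ofReal (Finset.sum_nonneg fun y _ => hx.mass_nonneg _),
    ← hx.sum_mass_atoms α l, Finset.sum_filter]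
  refine Eq.trans (Finset.sum_congr rfl fun y _ => ?_ :
    _ = ∑ y : AtomState.{u} ε l, mass ε x.theory (and α y.atom)) ?_
  · split_ifs with hy
    · have h := (y.mem_theory_iff hα).1 hy
      exact hx.mass_congr
        (Derives.of_valuation₁ (fun v hv => by simp only [hv.imp, hv.and]; tauto) h)
        (Derives.of_valuation fun v hv => by simp only [hv.imp, hv.and]; tauto)
    · have h := (provable_imp_of_mem_atoms y.atom_mem hα).resolve_left
        (mt (y.mem_theory_iff hα).2 hy)
      exact (hx.mass_eq_zero (Derives.of_valuation₁
        (fun v hv => by simp only [hv.imp, hv.and, hv.neg]; tauto) h)).symm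
  · -- Inconsistent atoms, which are not states, have mass zero.
    refine Finset.sum_of_injOn atom (fun y _ z _ h => ?_) (fun y _ => y.atom_mem) ?_ fun _ _ => rfl
    · exact ULift.down_injective (Subtype.ext (Subtype.ext h))
    · intro χ hχ hχ'
      refine hx.mass_eq_zero ?_
      have hcon : Derives ε {χ} bot := by
        by_contra hcon
        exact hχ' ⟨⟨⟨⟨χ, hχ⟩, hcon⟩⟩, Finset.mem_coe.2 (Finset.mem_univ _), rfl⟩
      rw [← insert_empty_eq] at hcon
      exact Derives.of_valuation₁ (fun v hv => by simp only [hv.and, hv.neg]; tauto)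
        hcon.neg_of_insert

end AtomState

/-- The finite model on the consistent atoms over a list of formulas. -/
noncomputable def atomKernel (ε : ℚ≥0) (l : List Formula) : Kernel.{u} where
  M := AtomState.{u} ε l
  analytic := ⟨AtomState.{u} ε l, inferInstance, inferInstance, id, .id, by
    rw [Set.range_id]; exact isClosed_univ.analyticSet⟩
  θ := AtomState.transition
  measurable_θ := .of_discrete
  finite_θ x := ⟨by
    classical
    rw [x.transition_apply]
    exact ENNReal.ofReal_lt_top⟩

/-- The list of subformulas of a formula. -/
def Formula.subformulas : Formula → List Formula
  | .top => [top]
  | .neg α => neg α :: α.subformulas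
  | .and α β => and α β :: (α.subformulas ++ β.subformulas)
  | .L r α => L r α :: α.subformulas

theorem Formula.self_mem_subformulas (α : Formula) : α ∈ α.subformulas := by
  cases α <;> simp [subformulas]

/-- The truth lemma. -/
theorem mem_den_atomKernel {l : List Formula} (hα : α.subformulas ⊆ l) (x : AtomState.{u} ε l) :
    x ∈ den (atomKernel.{u} ε l) ε α ↔ α ∈ x.theory := by
  have hx := x.isSaturated_theory
  induction α generalizing x with
  | top =>
    exact iff_of_true trivial (hx.mem_of_provable (Derives.of_valuation fun v hv => hv.top))
  | neg α ih =>
    simp only [subformulas, List.cons_subset] at hα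
    exact (not_congr (ih hα.2 x hx)).trans hx.neg_mem_iff.symm
  | and α β ih₁ ih₂ =>
    simp only [subformulas, List.cons_subset, List.append_subset] at hα
    exact (and_congr (ih₁ hα.2.1 x hx) (ih₂ hα.2.2 x hx)).trans hx.and_mem_iff.symm
  | L r α ih =>
    simp only [subformulas, List.cons_subset] at hα
    have h : den (atomKernel.{u} ε l) ε α = {y : AtomState.{u} ε l | α ∈ y.theory} :=
      Set.ext fun y => ih hα.2 y y.isSaturated_theory
    rw [hx.L_mem_iff, ← x.transition_real (hα.2 α.self_mem_subformulas), ← h]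
    rfl

/-- Every formula that is not provable fails at some state of a finite model. -/
theorem satisfiable_neg_of_not_provable (h : ¬ Provable ε α) : Satisfiable.{u} ε (neg α) := by
  have hcon : Consistent ε {neg α} := fun h' => h (by
    rw [← insert_empty_eq] at h'
    exact h'.of_insert_neg)
  obtain ⟨Γ, hαΓ, hΓ⟩ := exists_isSaturated hcon
  obtain ⟨χ, hχ, hχΓ⟩ := hΓ.exists_atom_mem α.subformulas
  have hχcon : Consistent ε {χ} := fun h' => by
    rw [← insert_empty_eq] at h'
    exact hΓ.neg_mem_iff.1 (hΓ.mem_of_provable h'.neg_of_insert) hχΓ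
  let x : AtomState.{u} ε α.subformulas := ⟨⟨⟨χ, hχ⟩, hχcon⟩⟩
  refine ⟨atomKernel ε α.subformulas, x, fun hx => ?_⟩
  have hx' := (mem_den_atomKernel (List.Subset.refl _) x).1 hx
  exact hΓ.neg_mem_iff.1 (hαΓ rfl)
    (hΓ.mp ((x.mem_theory_iff α.self_mem_subformulas).1 hx') hχΓ)

end CML

theorem mainTheorem1 (ε : ℚ≥0) (φ : CML.Formula) :
    CML.Provable ε φ ↔ CML.Valid.{u} ε φ := by
  refine ⟨fun h ⟨K, m, hm⟩ => hm (h.sound K m (by simp)), fun h => ?_⟩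
  by_contra hφ
  exact h (CML.satisfiable_neg_of_not_provable hφ)
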